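/- Let $\ell^2$ be the complex Hilbert space of square summable sequences $\{\alpha_n\}_{n\ge 0}$ with standard orthonormal basis $\{e_n\}_{n\ge 0}$. For a bounded sequence $\lambda=\{\lambda_n\}_{n\ge 0}\subseteq(0,\infty)$ let $W_\lambda$ be the unilateral weighted shift on $\ell^2$, i.e. the bounded operator with $W_\lambda e_n=\lambda_n e_{n+1}$, and put $\hat\lambda_0 = 1$, $\hat\lambda_n=\lambda_0^2\cdots\lambda_{n-1}^2$ for $n \ge 1$. A bounded operator $T$ on a complex Hilbert space is *conditionally positive definite* (CPD) if for every vector $h$ the sequence $\gamma_n=\|T^nh\|^2$ satisfies $\sum_{i,j=0}^k\gamma_{i+j}z_i\bar z_j\ge 0$ for all $k\ge 0$ and all $z_0,\dots,z_k\in\mathbb C$ with $\sum_{j=0}^k z_j=0$. Let $B_2(T)=I-2T^*T+T^{*2}T^2$; $T$ is a *2-isometry* if $B_2(T)=0$. If $W_\lambda$ is CPD, there is a unique triplet $(b,c,\nu)$, the *scalar representing triplet*, consisting of $b\in\mathbb R$, $c\ge 0$ and a compactly supported finite Borel measure $\nu$ on $[0,\infty)$ with $\nu(\{1\})=0$ such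 that $$\hat\lambda_n=1+bn+cn^2+\int_{[0,\infty)}Q_n\,d\nu,\qquad n\ge 0,$$ where $Q_0=Q_1=0$ and $Q_n(x)=\sum_{j=0}^{n-2}(n-j-1)x^j$ for $n\ge 2$. A CPD shift $W_\lambda$ is *of type I* if $\nu=0$ and $c=0$, and *of type III* if $\operatorname{supp}\nu\nsubseteq\{0\}$ or $c\ne 0$. For $a>0$ and $b\ge 1$ let $W_{a,b}$ be the unilateral weighted shift with weights $\lambda_0=\sqrt a$ and $\lambda_n=\sqrt{\frac{1+n(b-1)}{1+(n-1)(b-1)}}$ for $n\ge 1$. **Theorem.** Suppose that $W_\lambda$ is CPD. Let $\mathcal M$ be the closed linear span of $\{e_j : j\ge 1\}$, let $\mathcal E$ be the (algebraic) linear span of $\{e_n : n\ge 0\}$, and let $\|\cdot\|_2$ be the seminorm $\|h\|_2=\sqrt{\langle B_2(W_\lambda)h,h\rangle}$, $h\in\mathcal E$. Then the following conditions are equivalent: 1. the restriction $W_\lambda|_{\mathcal M}$ is not a 2-isometry; 2. $W_\lambda$ is of type III; 3. $W_\lambda\ne W_{a,b}$ for all $a\in(0,\infty)$ and $b\in[1,\infty)$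 such that $1-2a+ab\ge 0$; 4. $\|\cdot\|_2$ is a norm on $\mathcal E$. Moreover, if $W_\lambda=W_{a,b}$ for some $a\in(0,\infty)$ and $b\in[1,\infty)$ with $1-2a+ab\ge 0$, then $W_\lambda$ is of type I if and only if $1-2a+ab=0$. -/

import Mathlib

open scoped InnerProductSpace ComplexConjugate ComplexOrder NNReal

noncomputable section

namespace CPDShift

/-- The Hilbert space of square summable complex sequences indexed by the natural numbers. -/
abbrev L2 : Type := lp (fun _ : ℕ => ℂ) 2

/-- The standard orthonormal basis of `L2`. -/
def e (n : ℕ) : L2 := lp.single 2 n (1 : ℂ)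

/-! ### Unilateral weighted shifts -/

/-- Bounded sequences of positive real weights. -/
structure Weights where
  seq : ℕ → ℝ
  pos : ∀ n, 0 < seq n
  bdd : ∃ C : ℝ, ∀ n, seq n ≤ C

/-- The action of a weighted shift on sequences:
`(x 0, x 1, …)` is sent to `(0, lam 0 * x 0, lam 1 * x 1, …)`. -/
def shiftSeq (lam : ℕ → ℝ) (x : ℕ → ℂ) : ℕ → ℂ
  | 0 => 0
  | n + 1 => (lam n : ℂ) * x n

theorem summable_sq (x : L2) : Summable fun n => ‖x n‖ ^ 2 := by
  have h := (memℓp_gen_iff (p := 2) (by norm_num)).1 (lp.memℓp x)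
  simpa using h

theorem shiftSeq_sq_le (lam : Weights) {C : ℝ} (hC : ∀ n, lam.seq n ≤ C) (x : ℕ → ℂ) (n : ℕ) :
    ‖shiftSeq lam.seq x (n + 1)‖ ^ 2 ≤ C ^ 2 * ‖x n‖ ^ 2 := by
  have h : ‖shiftSeq lam.seq x (n + 1)‖ = lam.seq n * ‖x n‖ := by
    simp [shiftSeq, abs_of_pos (lam.pos n)]
  rw [h, mul_pow]
  have h1 : lam.seq n ^ 2 ≤ C ^ 2 := pow_le_pow_left₀ (lam.pos n).le (hC n) 2
  exact mul_le_mul_of_nonneg_right h1 (by positivity)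

theorem shiftSeq_summable (lam : Weights) (x : L2) :
    Summable fun n => ‖shiftSeq lam.seq x n‖ ^ 2 := by
  obtain ⟨C, hC⟩ := lam.bdd
  rw [← summable_nat_add_iff 1]
  exact Summable.of_nonneg_of_le (fun n => by positivity)
    (fun n => shiftSeq_sq_le lam hC x n) ((summable_sq x).mul_left (C ^ 2))

theorem shiftSeq_memℓp (lam : Weights) (x : L2) :
    Memℓp (E := fun _ : ℕ => ℂ) (shiftSeq lam.seq x) 2 := by
  refine memℓp_gen ?_
  simpa using shiftSeq_summable lam x

/-- The weighted shift as a linear map. -/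
def shiftLin (lam : Weights) : L2 →ₗ[ℂ] L2 where
  toFun x := ⟨shiftSeq lam.seq x, shiftSeq_memℓp lam x⟩
  map_add' x y := by
    ext n
    change shiftSeq lam.seq (x + y : L2) n = shiftSeq lam.seq x n + shiftSeq lam.seq y n
    cases n <;> simp [shiftSeq, mul_add]
  map_smul' c x := by
    ext n
    change shiftSeq lam.seq (c • x : L2) n = c * shiftSeq lam.seq x n
    cases n <;> simp [shiftSeq, mul_left_comm]

theorem norm_sq_eq (x : L2) : ‖x‖ ^ 2 = ∑' n, ‖x n‖ ^ 2 := by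
  have h := lp.norm_rpow_eq_tsum (p := 2) (by norm_num) x
  simpa using h

theorem shiftLin_bound (lam : Weights) : ∃ C : ℝ, ∀ x, ‖shiftLin lam x‖ ≤ C * ‖x‖ := by
  obtain ⟨C, hC⟩ := lam.bdd
  have hC0 : 0 ≤ C := (lam.pos 0).le.trans (hC 0)
  refine ⟨C, fun x => ?_⟩
  refine le_of_sq_le_sq ?_ (by positivity)
  rw [mul_pow, norm_sq_eq, norm_sq_eq x, ← tsum_mul_left]
  have hs := shiftSeq_summable lam x
  have h0 : ∑' n, ‖shiftLin lam x n‖ ^ 2 = ∑' n, ‖shiftSeq lam.seq x (n + 1)‖ ^ 2 := by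
    have := hs.tsum_eq_zero_add
    simpa [shiftLin, shiftSeq] using this
  rw [h0]
  exact Summable.tsum_le_tsum (fun n => shiftSeq_sq_le lam hC x n)
    ((summable_nat_add_iff 1).2 hs) ((summable_sq x).mul_left (C ^ 2))

/-- The unilateral weighted shift with weights `lam`, a bounded operator on `L2`. -/
def W (lam : Weights) : L2 →L[ℂ] L2 :=
  (shiftLin lam).mkContinuousOfExistsBound (shiftLin_bound lam)

theorem W_e (lam : Weights) (n : ℕ) : W lam (e n) = (lam.seq n : ℂ) • e (n + 1) := by
  ext k
  change shiftSeq lam.seq (e n) k = (lam.seq n : ℂ) * e (n + 1) k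
  cases k with
  | zero => simp [shiftSeq, e]
  | succ k =>
    by_cases h : k = n
    · subst h; simp [shiftSeq, e]
    · simp [shiftSeq, e, h]

/-- The formal moment sequence: the product of the squares of the first `n` weights. -/
def moment (lam : Weights) (n : ℕ) : ℝ := ∏ i ∈ Finset.range n, lam.seq i ^ 2

/-- The weights of the model shift with parameters `a` and `b`. -/
def modelSeq (a b : ℝ) (n : ℕ) : ℝ :=
  if n = 0 then √a
  else √((1 + (n : ℝ) * (b - 1)) / (1 + ((n : ℝ) - 1) * (b - 1)))

theorem modelSeq_aux {b : ℝ} (hb : 1 ≤ b) {n : ℕ} (hn : n ≠ 0) :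
    0 < 1 + (n : ℝ) * (b - 1) ∧ 0 < 1 + ((n : ℝ) - 1) * (b - 1) ∧ 0 ≤ ((n : ℝ) - 1) * (b - 1) := by
  have h1 : (1 : ℝ) ≤ n := by exact_mod_cast Nat.one_le_iff_ne_zero.2 hn
  have h2 : 0 ≤ (n : ℝ) * (b - 1) := mul_nonneg (by linarith) (by linarith)
  have h3 : 0 ≤ ((n : ℝ) - 1) * (b - 1) := mul_nonneg (by linarith) (by linarith)
  exact ⟨by linarith, by linarith, h3⟩

theorem modelSeq_pos {a b : ℝ} (ha : 0 < a) (hb : 1 ≤ b) (n : ℕ) : 0 < modelSeq a b n := by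
  unfold modelSeq
  split_ifs with hn
  · exact Real.sqrt_pos.2 ha
  · obtain ⟨h1, h2, -⟩ := modelSeq_aux hb hn
    exact Real.sqrt_pos.2 (div_pos h1 h2)

theorem modelSeq_bdd {a b : ℝ} (hb : 1 ≤ b) : ∃ C : ℝ, ∀ n, modelSeq a b n ≤ C := by
  refine ⟨max (√a) (√b), fun n => ?_⟩
  unfold modelSeq
  split_ifs with hn
  · exact le_max_left _ _
  · refine le_trans (Real.sqrt_le_sqrt ?_) (le_max_right _ _)
    obtain ⟨h1, h2, h3⟩ := modelSeq_aux hb hn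
    rw [div_le_iff₀ h2]
    nlinarith

/-- The weights of the model shift, bundled. -/
def modelWeights (a b : ℝ) (ha : 0 < a) (hb : 1 ≤ b) : Weights where
  seq := modelSeq a b
  pos := modelSeq_pos ha hb
  bdd := modelSeq_bdd hb

/-- The model shift `W_{a,b}`. -/
def Wab (a b : ℝ) (ha : 0 < a) (hb : 1 ≤ b) : L2 →L[ℂ] L2 := W (modelWeights a b ha hb)

/-! ### Conditional positive definiteness and `m`-isometries -/

/-- Conditionally positive definite real sequences. -/
def IsCPDSeq (γ : ℕ → ℝ) : Prop :=
  ∀ (k : ℕ) (z : ℕ → ℂ), ∑ j ∈ Finset.range (k + 1), z j = 0 →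
    0 ≤ ∑ i ∈ Finset.range (k + 1), ∑ j ∈ Finset.range (k + 1), (γ (i + j) : ℂ) * z i * conj (z j)

section Operators

variable {H : Type*} [NormedAddCommGroup H] [InnerProductSpace ℂ H]

/-- Conditionally positive definite operators. -/
def IsCPD (T : H →L[ℂ] H) : Prop :=
  ∀ h : H, IsCPDSeq fun n => ‖(T ^ n) h‖ ^ 2

variable [CompleteSpace H]

/-- `∑ₖ (-1)ᵏ (m choose k) T*ᵏ Tᵏ`, the sum being over `0 ≤ k ≤ m`. -/
def B (m : ℕ) (T : H →L[ℂ] H) : H →L[ℂ] H :=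
  ∑ k ∈ Finset.range (m + 1),
    ((-1 : ℂ) ^ k * (m.choose k : ℂ)) • (ContinuousLinearMap.adjoint T ^ k * T ^ k)

/-- `m`-isometries (used for `m ≥ 1`). -/
def IsMIsometry (m : ℕ) (T : H →L[ℂ] H) : Prop := B m T = 0

end Operators

/-- The closed linear span of `e 1, e 2, …`. -/
def M : Submodule ℂ L2 :=
  (Submodule.span ℂ {x | ∃ j : ℕ, 1 ≤ j ∧ x = e j}).topologicalClosure

instance : CompleteSpace M :=
  Submodule.topologicalClosure.completeSpace _

theorem W_mapsTo_M (lam : Weights) : ∀ x ∈ M, W lam x ∈ M := by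
  set S : Submodule ℂ L2 := Submodule.span ℂ {x | ∃ j : ℕ, 1 ≤ j ∧ x = e j} with hS
  have h1 : S ≤ S.comap (W lam).toLinearMap := by
    refine Submodule.span_le.2 ?_
    rintro _ ⟨j, -, rfl⟩
    change W lam (e j) ∈ S
    rw [W_e]
    exact S.smul_mem _ (Submodule.subset_span ⟨j + 1, by omega, rfl⟩)
  intro x hx
  exact map_mem_closure (W lam).continuous hx h1

/-- The restriction of the weighted shift to its invariant subspace `M`, as an operator on `M`. -/
def WM (lam : Weights) : M →L[ℂ] M :=
  ((W lam).comp M.subtypeL).codRestrict M fun x => W_mapsTo_M lam x x.2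

/-! ### The scalar representing triplet and the types -/

/-- The polynomials `Q n`; the sum is empty for `n = 0, 1`, and the truncated subtractions are
exact on the range of summation. -/
def Q (n : ℕ) (x : ℝ) : ℝ := ∑ j ∈ Finset.range (n - 1), ((n - j - 1 : ℕ) : ℝ) * x ^ j

/-- `(b, c, ν)` is the scalar representing triplet of the weighted shift with weights `lam`;
`ν` is a Borel measure on the closed half-line `[0, ∞)`. -/
structure IsScalarTriplet (lam : Weights) (b c : ℝ) (ν : MeasureTheory.Measure ℝ≥0) : Prop where
  c_nonneg : 0 ≤ c
  finite : MeasureTheory.IsFiniteMeasure ν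
  compact_support : IsCompact ν.support
  one_null : ν {1} = 0
  moment_eq : ∀ n : ℕ, moment lam n = 1 + b * n + c * (n : ℝ) ^ 2 + ∫ x, Q n (x : ℝ) ∂ν

/-- The weighted shift is conditionally positive definite, of type I. -/
def IsTypeI (lam : Weights) : Prop :=
  IsCPD (W lam) ∧ ∃ (b c : ℝ) (ν : MeasureTheory.Measure ℝ≥0),
    IsScalarTriplet lam b c ν ∧ ν = 0 ∧ c = 0

/-- The weighted shift is conditionally positive definite, of type III. -/
def IsTypeIII (lam : Weights) : Prop :=
  IsCPD (W lam) ∧ ∃ (b c : ℝ) (ν : MeasureTheory.Measure ℝ≥0),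
    IsScalarTriplet lam b c ν ∧ (¬ ν.support ⊆ {0} ∨ c ≠ 0)

/-! ### The seminorm -/

/-- The (algebraic) linear span of `e 0, e 1, …`. -/
def E : Submodule ℂ L2 := Submodule.span ℂ (Set.range e)

/-- `h ↦ ⟨B₂(W) h, h⟩ ^ (1 / 2)` on `E`. -/
def norm2 (lam : Weights) (h : E) : ℝ := √(RCLike.re ⟪B 2 (W lam) (h : L2), (h : L2)⟫_ℂ)

/-- The function `p` is a norm on the complex vector space `V`. -/
structure IsNorm {V : Type*} [AddCommGroup V] [Module ℂ V] (p : V → ℝ) : Prop where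
  nonneg : ∀ v, 0 ≤ p v
  eq_zero_iff : ∀ v, p v = 0 ↔ v = 0
  smul : ∀ (c : ℂ) (v : V), p (c • v) = ‖c‖ * p v
  add_le : ∀ v w, p (v + w) ≤ p v + p w

end CPDShift

end

/-!
Let `γ n = ‖W ^ n e₀‖ ^ 2` be the moments of the shift and `β n = γ (n + 2) - 2 γ (n + 1) + γ n`
their second differences (`secondDiff (moment lam)`). The operator `B 2 W` is diagonal, with
eigenvalues `β n / γ n` (`eigB`, `hasSum_eigB`), so `W` restricted to `M` is a 2-isometry iff
`β n = 0` for all `n ≥ 1`, and the seminorm is a norm iff `β n > 0` for all `n`. Solving the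
recursion `β n = 0`, `n ≥ 1`, shows that it holds exactly for the model shifts (`exists_model`,
`eigB_succ_of_model`).

The link with the type is the identity `β n = 2 c + ∫ xⁿ dν` for a scalar representing triplet
(`IsScalarTriplet.secondDiff_eq`), a consequence of `Q (n + 2) - 2 Q (n + 1) + Q n = xⁿ`. If
`c ≠ 0` or `ν` charges `(0, ∞)`, then every `β n` is positive; otherwise `β n = 0` for `n ≥ 1`.
So the conditions are all equivalent once a triplet is known to exist, and type I means `β = 0`.

Existence of the triplet (`exists_isScalarTriplet`) is a moment problem. Conditional positive
definiteness at `e₀` and at `e₁`, tested on the coefficients of `(X - 1) q`, says that the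
functional `L (Xⁿ) = β n` is nonnegative on the polynomials `q²` and `X q²`. As `β` grows at most
geometrically, log-convexity of `n ↦ L (Xⁿ q²)` gives nonnegativity on `(R - X) q²` for some `R`
(`isPositiveOn_of_growth`). By factorization `L` is then nonnegative on all polynomials that are
nonnegative on `[0, R]` (`IsPositiveOn.nonneg`); M. Riesz' extension theorem and the
Riesz–Markov–Kakutani theorem turn `L` into a measure `μ` (`IsPositiveOn.exists_measure`). Its mass
at `1` becomes `2 c`, and the rest of it is `ν`.
-/

namespace CPDShift

/-! ### Positive functionals on polynomials over an interval -/

section Polynomials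

open Polynomial MeasureTheory
open scoped CompactlySupported

theorem linearMap_C_mul (L : ℝ[X] →ₗ[ℝ] ℝ) (r : ℝ) (p : ℝ[X]) : L (C r * p) = r * L p := by
  rw [← smul_eq_C_mul, map_smul, smul_eq_mul]

/-- Division by a nonnegative factor on an interval; the zeros of the factor are dealt with by
density of their complement. -/
theorem eval_nonneg_of_mul_nonneg {a b : ℝ} (hab : a < b) {s t : ℝ[X]} (hs0 : s ≠ 0)
    (hs : ∀ x ∈ Set.Icc a b, 0 ≤ s.eval x) (hst : ∀ x ∈ Set.Icc a b, 0 ≤ (s * t).eval x) :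
    ∀ x ∈ Set.Icc a b, 0 ≤ t.eval x := by
  have hd : Dense {x : ℝ | s.eval x = 0}ᶜ :=
    (Polynomial.finite_setOfPred_isRoot hs0).countable.dense_compl ℝ
  have hc : IsClosed {x : ℝ | 0 ≤ t.eval x} :=
    isClosed_le continuous_const t.continuous
  have hsub : Set.Ioo a b ∩ {x : ℝ | s.eval x = 0}ᶜ ⊆ {x : ℝ | 0 ≤ t.eval x} := by
    rintro x ⟨hx, hx0⟩
    have hx' := Set.Ioo_subset_Icc_self hx
    have h1 : 0 < s.eval x := lt_of_le_of_ne (hs x hx') (Ne.symm hx0)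
    have h2 := hst x hx'
    rw [eval_mul] at h2
    exact nonneg_of_mul_nonneg_right h2 h1
  have h3 : Set.Ioo a b ⊆ {x : ℝ | 0 ≤ t.eval x} :=
    (hd.open_subset_closure_inter isOpen_Ioo).trans (hc.closure_subset_iff.2 hsub)
  have h4 := hc.closure_subset_iff.2 h3
  rwa [closure_Ioo hab.ne] at h4

/-- The positivity conditions on a linear functional on real polynomials which, for
`R > 0`, characterize integration against a measure on `[0, R]`: nonnegativity on the multiples of
squares by the linear polynomials `X` and `R - X`. -/
structure IsPositiveOn (R : ℝ) (L : ℝ[X] →ₗ[ℝ] ℝ) : Prop where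
  X_mul_sq : ∀ q : ℝ[X], 0 ≤ L (X * q ^ 2)
  sub_mul_sq : ∀ q : ℝ[X], 0 ≤ L ((C R - X) * q ^ 2)

namespace IsPositiveOn

variable {R : ℝ} {L : ℝ[X] →ₗ[ℝ] ℝ}

theorem sq (hR : 0 < R) (hL : IsPositiveOn R L) (q : ℝ[X]) : 0 ≤ L (q ^ 2) := by
  have h : L (C R * q ^ 2) = L (X * q ^ 2) + L ((C R - X) * q ^ 2) := by
    rw [← map_add]; congr 1; ring
  rw [linearMap_C_mul] at h
  exact nonneg_of_mul_nonneg_right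
    (h ▸ add_nonneg (hL.X_mul_sq q) (hL.sub_mul_sq q)) hR

/-- This rests on `R X (R - X) = X² (R - X) + X (R - X)²`. -/
theorem X_mul_sub_mul_sq (hR : 0 < R) (hL : IsPositiveOn R L) (q : ℝ[X]) :
    0 ≤ L (X * (C R - X) * q ^ 2) := by
  have h : L (C R * (X * (C R - X) * q ^ 2)) =
      L ((C R - X) * (X * q) ^ 2) + L (X * ((C R - X) * q) ^ 2) := by
    rw [← map_add]; congr 1; ring
  rw [linearMap_C_mul] at h
  exact nonneg_of_mul_nonneg_right
    (h ▸ add_nonneg (hL.sub_mul_sq _) (hL.X_mul_sq _)) hR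

/-! Positivity on `[0, R]` passes to the functional `p ↦ L (s * p)` for each of the factors `s` into
which a nonnegative polynomial on `[0, R]` decomposes. -/

theorem comp_mul_sq_add (hL : IsPositiveOn R L) (s : ℝ[X]) {r : ℝ} (hr : 0 ≤ r) :
    IsPositiveOn R (L ∘ₗ LinearMap.mulLeft ℝ (s ^ 2 + C r)) where
  X_mul_sq q := by
    have h1 := hL.X_mul_sq (s * q)
    have h2 := mul_nonneg hr (hL.X_mul_sq q)
    rw [← linearMap_C_mul] at h2
    refine (add_nonneg h1 h2).trans_eq ?_
    rw [← map_add]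
    simp only [LinearMap.comp_apply, LinearMap.mulLeft_apply]; congr 1; ring
  sub_mul_sq q := by
    have h1 := hL.sub_mul_sq (s * q)
    have h2 := mul_nonneg hr (hL.sub_mul_sq q)
    rw [← linearMap_C_mul] at h2
    refine (add_nonneg h1 h2).trans_eq ?_
    rw [← map_add]
    simp only [LinearMap.comp_apply, LinearMap.mulLeft_apply]; congr 1; ring

theorem comp_mul_sq (hL : IsPositiveOn R L) (s : ℝ[X]) :
    IsPositiveOn R (L ∘ₗ LinearMap.mulLeft ℝ (s ^ 2)) := by
  simpa using hL.comp_mul_sq_add s le_rfl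

theorem comp_mul_X_sub (hR : 0 < R) (hL : IsPositiveOn R L) {r : ℝ} (hr : r ≤ 0) :
    IsPositiveOn R (L ∘ₗ LinearMap.mulLeft ℝ (X - C r)) where
  X_mul_sq q := by
    have h1 := hL.sq hR (X * q)
    have h2 := mul_nonneg (neg_nonneg.2 hr) (hL.X_mul_sq q)
    rw [← linearMap_C_mul] at h2
    refine (add_nonneg h1 h2).trans_eq ?_
    rw [← map_add]
    simp only [LinearMap.comp_apply, LinearMap.mulLeft_apply, map_neg]; congr 1; ring
  sub_mul_sq q := by
    have h1 := hL.X_mul_sub_mul_sq hR q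
    have h2 := mul_nonneg (neg_nonneg.2 hr) (hL.sub_mul_sq q)
    rw [← linearMap_C_mul] at h2
    refine (add_nonneg h1 h2).trans_eq ?_
    rw [← map_add]
    simp only [LinearMap.comp_apply, LinearMap.mulLeft_apply, map_neg]; congr 1; ring

theorem comp_mul_sub_X (hR : 0 < R) (hL : IsPositiveOn R L) {r : ℝ} (hr : R ≤ r) :
    IsPositiveOn R (L ∘ₗ LinearMap.mulLeft ℝ (C r - X)) where
  X_mul_sq q := by
    have h1 := hL.X_mul_sub_mul_sq hR q
    have h2 := mul_nonneg (sub_nonneg.2 hr) (hL.X_mul_sq q)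
    rw [← linearMap_C_mul] at h2
    refine (add_nonneg h1 h2).trans_eq ?_
    rw [← map_add]
    simp only [LinearMap.comp_apply, LinearMap.mulLeft_apply, map_sub]; congr 1; ring
  sub_mul_sq q := by
    have h1 := hL.sq hR ((C R - X) * q)
    have h2 := mul_nonneg (sub_nonneg.2 hr) (hL.sub_mul_sq q)
    rw [← linearMap_C_mul] at h2
    refine (add_nonneg h1 h2).trans_eq ?_
    rw [← map_add]
    simp only [LinearMap.comp_apply, LinearMap.mulLeft_apply, map_sub]; congr 1; ring

/-- Induction on the degree: a factor of `p` coming from a complex root is moved into the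
functional. Roots in `(0, R)` are double because `p` does not change sign there. -/
theorem nonneg_of_natDegree_le (hR : 0 < R) (n : ℕ) : ∀ {L : ℝ[X] →ₗ[ℝ] ℝ}, IsPositiveOn R L →
    ∀ p : ℝ[X], p.natDegree ≤ n → (∀ x ∈ Set.Icc 0 R, 0 ≤ p.eval x) → 0 ≤ L p := by
  induction n using Nat.strong_induction_on with
  | _ n ih =>
  intro L hL p hpn hp
  by_cases hdeg : p.natDegree = 0
  · obtain ⟨a, rfl⟩ := natDegree_eq_zero.1 hdeg
    have ha : 0 ≤ a := by simpa using hp 0 ⟨le_rfl, hR.le⟩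
    have h1 := mul_nonneg ha (hL.sq hR 1)
    rwa [← linearMap_C_mul, one_pow, mul_one] at h1
  have hp0 : p ≠ 0 := by rintro rfl; simp at hdeg
  have step : ∀ s t : ℝ[X], p = s * t → 0 < s.natDegree → (∀ x ∈ Set.Icc 0 R, 0 ≤ s.eval x) →
      IsPositiveOn R (L ∘ₗ LinearMap.mulLeft ℝ s) → 0 ≤ L p := by
    intro s t hst hs hs' hLs
    have hs0 : s ≠ 0 := by rintro rfl; simp at hs
    have ht0 : t ≠ 0 := by rintro rfl; simp at hst; exact hp0 hst
    have hd := natDegree_mul hs0 ht0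
    rw [← hst] at hd
    have := ih t.natDegree (by omega) hLs t le_rfl
      (eval_nonneg_of_mul_nonneg hR hs0 hs' (hst ▸ hp))
    rw [hst]
    simpa using this
  obtain ⟨z, hz⟩ : ∃ z : ℂ, aeval z p = 0 := by
    refine IsAlgClosed.exists_aeval_eq_zero ℂ p ?_
    intro h
    exact hdeg (natDegree_eq_of_degree_eq_some h)
  by_cases him : z.im = 0
  · set r := z.re
    have hroot : p.IsRoot r := by
      have hzr : z = (r : ℂ) := Complex.ext rfl (by simpa using him)
      rw [hzr, show ((r : ℝ) : ℂ) = algebraMap ℝ ℂ r from rfl, aeval_algebraMap_apply] at hz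
      simpa using hz
    obtain ⟨t, ht⟩ := dvd_iff_isRoot.2 hroot
    rcases le_or_gt r 0 with h0 | h0
    · refine step _ t ht (by simp) ?_ (hL.comp_mul_X_sub hR h0)
      intro x hx
      simp only [eval_sub, eval_X, eval_C]
      linarith [hx.1]
    rcases le_or_gt R r with h1 | h1
    · refine step (C r - X) (-t) (by rw [ht]; ring) ?_ ?_ (hL.comp_mul_sub_X hR h1)
      · rw [← neg_sub, natDegree_neg, natDegree_X_sub_C]; exact one_pos
      intro x hx
      simp only [eval_sub, eval_X, eval_C]
      linarith [hx.2]
    -- `t` is nonnegative to the right of `r` and nonpositive to the left, so it vanishes at `r`.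
    have ht1 : 0 ≤ t.eval r := by
      refine eval_nonneg_of_mul_nonneg h1 (X_sub_C_ne_zero r) ?_ ?_ r ⟨le_rfl, h1.le⟩
      · intro x hx
        simpa using hx.1
      · intro x hx
        rw [← ht]
        exact hp x ⟨h0.le.trans hx.1, hx.2⟩
    have ht2 : 0 ≤ (-t).eval r := by
      refine eval_nonneg_of_mul_nonneg h0 (neg_ne_zero.2 (X_sub_C_ne_zero r)) ?_ ?_ r
        ⟨h0.le, le_rfl⟩
      · intro x hx
        simpa using hx.2
      · intro x hx
        rw [neg_mul_neg, ← ht]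
        exact hp x ⟨hx.1, hx.2.trans h1.le⟩
    rw [eval_neg] at ht2
    obtain ⟨u, hu⟩ := dvd_iff_isRoot.2 (show t.IsRoot r from le_antisymm (by linarith) ht1)
    refine step ((X - C r) ^ 2) u (by rw [ht, hu]; ring) (by simp) ?_ (hL.comp_mul_sq _)
    intro x _
    rw [eval_pow]
    positivity
  · obtain ⟨t, ht⟩ := Polynomial.quadratic_dvd_of_aeval_eq_zero_im_ne_zero p hz him
    have hs : X ^ 2 - C (2 * z.re) * X + C (‖z‖ ^ 2) =
        (X - C z.re) ^ 2 + C (z.im ^ 2) := by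
      rw [← Complex.normSq_eq_norm_sq, Complex.normSq_apply]
      simp only [map_mul, map_add, map_pow, map_ofNat]
      ring
    rw [hs] at ht
    refine step _ t ht ?_ ?_ (hL.comp_mul_sq_add _ (_root_.sq_nonneg _))
    · rw [natDegree_add_C]; simp
    · intro x _
      simp only [eval_add, eval_pow, eval_C]
      positivity

theorem nonneg (hR : 0 < R) (hL : IsPositiveOn R L) {p : ℝ[X]}
    (hp : ∀ x ∈ Set.Icc 0 R, 0 ≤ p.eval x) : 0 ≤ L p :=
  nonneg_of_natDegree_le hR _ hL p le_rfl hp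

end IsPositiveOn

/-- Growth forces the support condition at the right end point: the moments `L (Xⁿ q²)` are
log-convex, so if `L (X q²) > R L (q²)` they would grow faster than `Rⁿ`. -/
theorem isPositiveOn_of_growth {R K : ℝ} {L : ℝ[X] →ₗ[ℝ] ℝ} (hR : 0 < R)
    (h0 : ∀ q : ℝ[X], 0 ≤ L (q ^ 2)) (h1 : ∀ q : ℝ[X], 0 ≤ L (X * q ^ 2))
    (hK : ∀ n : ℕ, |L (X ^ n)| ≤ K * R ^ n) : IsPositiveOn R L := by
  refine ⟨h1, fun q => ?_⟩
  set s : ℕ → ℝ := fun n => L (X ^ n * q ^ 2) with hs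
  have hXsq : ∀ n : ℕ, ∀ u : ℝ[X], 0 ≤ L (X ^ n * u ^ 2) := by
    intro n u
    rcases Nat.even_or_odd' n with ⟨m, rfl | rfl⟩
    · convert h0 (X ^ m * u) using 2; ring
    · convert h1 (X ^ m * u) using 2; ring
  have hs0 : ∀ n, 0 ≤ s n := fun n => hXsq n q
  have hquad : ∀ n (r : ℝ), 0 ≤ s (n + 2) - 2 * r * s (n + 1) + r ^ 2 * s n := by
    intro n r
    have := hXsq n ((X - C r) * q)
    have he : X ^ n * ((X - C r) * q) ^ 2 =
        X ^ (n + 2) * q ^ 2 - C (2 * r) * (X ^ (n + 1) * q ^ 2)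
          + C (r ^ 2) * (X ^ n * q ^ 2) := by
      simp only [map_mul, map_pow, map_ofNat]; ring
    rwa [he, map_add, map_sub, linearMap_C_mul, linearMap_C_mul] at this
  obtain ⟨K', hK'⟩ : ∃ K' : ℝ, ∀ n, s n ≤ K' * R ^ n := by
    refine ⟨∑ i ∈ Finset.range ((q ^ 2).natDegree + 1), |(q ^ 2).coeff i| * (K * R ^ i),
      fun n => ?_⟩
    have : s n = ∑ i ∈ Finset.range ((q ^ 2).natDegree + 1),
        (q ^ 2).coeff i * L (X ^ (n + i)) := by
      simp only [hs]
      conv_lhs => rw [(q ^ 2).as_sum_range_C_mul_X_pow, Finset.mul_sum, map_sum]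
      refine Finset.sum_congr rfl fun i _ => ?_
      rw [← linearMap_C_mul]
      congr 1; ring
    rw [this, Finset.sum_mul]
    refine Finset.sum_le_sum fun i _ => ?_
    calc (q ^ 2).coeff i * L (X ^ (n + i)) ≤ |(q ^ 2).coeff i| * |L (X ^ (n + i))| := by
          rw [← abs_mul]; exact le_abs_self _
      _ ≤ |(q ^ 2).coeff i| * (K * R ^ (n + i)) := by gcongr; exact hK _
      _ = _ := by ring
  have hgoal : L ((C R - X) * q ^ 2) = R * s 0 - s 1 := by
    rw [sub_mul, map_sub, linearMap_C_mul]
    simp [hs]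
  rw [hgoal]
  by_contra! hlt
  have hs0pos : 0 < s 0 := by
    refine lt_of_le_of_ne (hs0 0) fun h => ?_
    have h1' : 0 < s 1 := by rw [← h] at hlt; linarith
    -- With `s 0 = 0` the quadratic in `r` is affine; at this `r` it equals `-s 2 - 2 < 0`.
    have := hquad 0 ((s 2 + 1) / s 1)
    rw [← h] at this
    have hx : (s 2 + 1) / s 1 * s 1 = s 2 + 1 := by field_simp
    simp only [zero_add] at this
    nlinarith [hs0 2]
  set ρ := s 1 / s 0 with hρ
  have hρR : R < ρ := by rw [hρ, lt_div_iff₀ hs0pos]; linarith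
  have hρ1 : ρ * s 0 = s 1 := by rw [hρ]; field_simp
  have hgrow : ∀ n, 0 < s n ∧ ρ * s n ≤ s (n + 1) := by
    intro n
    induction n with
    | zero => exact ⟨hs0pos, hρ1.le⟩
    | succ n ih =>
      have hpos : 0 < s (n + 1) := lt_of_lt_of_le (mul_pos (hR.trans hρR) ih.1) ih.2
      refine ⟨hpos, ?_⟩
      have := hquad n ρ
      nlinarith [mul_le_mul_of_nonneg_left ih.2 (hR.trans hρR).le]
  have hpow : ∀ n, s 0 * ρ ^ n ≤ s n := by
    intro n
    induction n with
    | zero => simp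
    | succ n ih =>
      calc s 0 * ρ ^ (n + 1) = ρ * (s 0 * ρ ^ n) := by ring
        _ ≤ ρ * s n := mul_le_mul_of_nonneg_left ih (hR.trans hρR).le
        _ ≤ _ := (hgrow n).2
  have hratio : 1 < ρ / R := by rwa [one_lt_div hR]
  obtain ⟨n, hn⟩ := pow_unbounded_of_one_lt (K' / s 0) hratio
  have h3 := (hpow n).trans (hK' n)
  rw [div_pow, div_lt_div_iff₀ hs0pos (by positivity)] at hn
  linarith

/-! ### The moment problem on a compact interval -/

/-- Restriction of real polynomials to a set of nonnegative real numbers. -/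
noncomputable def polyRestrict (S : Set ℝ≥0) : ℝ[X] →ₗ[ℝ] C(S, ℝ) where
  toFun p := ⟨fun x => p.eval ((x : ℝ≥0) : ℝ), by fun_prop⟩
  map_add' p q := by ext; simp
  map_smul' c p := by ext; simp

@[simp]
theorem polyRestrict_apply (S : Set ℝ≥0) (p : ℝ[X]) (x : S) :
    polyRestrict S p x = p.eval ((x : ℝ≥0) : ℝ) := rfl

theorem polyRestrict_injective {R : ℝ≥0} (hR : 0 < R) :
    Function.Injective (polyRestrict (Set.Icc 0 R)) := by
  rw [injective_iff_map_eq_zero]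
  intro p hp
  refine Polynomial.eq_zero_of_infinite_isRoot p ((Set.Icc_infinite (NNReal.coe_pos.2 hR)).mono ?_)
  intro x hx
  exact congrArg (fun f : C(Set.Icc 0 R, ℝ) => f ⟨⟨x, hx.1⟩, hx.1, hx.2⟩) hp

/-- The extension step in the moment problem: M. Riesz' theorem applied to the polynomials inside
`C([0, R])`. Constants dominate every continuous function. -/
theorem IsPositiveOn.exists_extension {R : ℝ≥0} (hR : 0 < R) {L : ℝ[X] →ₗ[ℝ] ℝ}
    (hL : IsPositiveOn R L) : ∃ g : C(Set.Icc 0 R, ℝ) →ₗ[ℝ] ℝ,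
      (∀ p, g (polyRestrict _ p) = L p) ∧ ∀ f, 0 ≤ f → 0 ≤ g f := by
  set j := LinearEquiv.ofInjective _ (polyRestrict_injective hR) with hj
  let f : C(Set.Icc 0 R, ℝ) →ₗ.[ℝ] ℝ :=
    ⟨LinearMap.range (polyRestrict (Set.Icc 0 R)), L ∘ₗ j.symm.toLinearMap⟩
  have hf : ∀ x : f.domain, (x : C(Set.Icc 0 R, ℝ)) ∈ PointedCone.positive ℝ C(Set.Icc 0 R, ℝ) →
      0 ≤ f x := by
    rintro ⟨_, p, rfl⟩ hx
    have hjp : j.symm ⟨polyRestrict (Set.Icc 0 R) p, ⟨p, rfl⟩⟩ = p := by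
      rw [LinearEquiv.symm_apply_eq]; rfl
    change 0 ≤ L (j.symm _)
    rw [hjp]
    refine hL.nonneg (NNReal.coe_pos.2 hR) fun x hx' => ?_
    have h0 : (0 : C(Set.Icc 0 R, ℝ)) ≤ polyRestrict _ p := by simpa using hx
    exact h0 ⟨⟨x, hx'.1⟩, hx'.1, hx'.2⟩
  have hdom : ∀ y, ∃ x : f.domain, (x : C(Set.Icc 0 R, ℝ)) + y ∈
      PointedCone.positive ℝ C(Set.Icc 0 R, ℝ) := by
    intro y
    refine ⟨⟨polyRestrict _ (C ‖y‖), ⟨_, rfl⟩⟩, ?_⟩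
    rw [PointedCone.mem_positive]
    intro x
    have := neg_le_of_abs_le (y.norm_coe_le_norm x)
    simp
    linarith
  obtain ⟨g, hg1, hg2⟩ := riesz_extension _ f hf hdom
  refine ⟨g, fun p => ?_, fun f hf => hg2 f (by simpa using hf)⟩
  have h : g (j p) = L (j.symm (j p)) := hg1 (j p)
  rwa [j.symm_apply_apply] at h

/-- Solution of the moment problem on `[0, R]`, by the Riesz–Markov–Kakutani theorem. -/
theorem IsPositiveOn.exists_measure {R : ℝ} (hR : 0 < R) {L : ℝ[X] →ₗ[ℝ] ℝ}
    (hL : IsPositiveOn R L) : ∃ μ : Measure ℝ≥0, IsFiniteMeasure μ ∧ IsCompact μ.support ∧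
      ∀ p : ℝ[X], ∫ x : ℝ≥0, p.eval (x : ℝ) ∂μ = L p := by
  lift R to ℝ≥0 using hR.le
  obtain ⟨g, hg, hpos⟩ := hL.exists_extension (NNReal.coe_pos.1 hR)
  let T : C_c(Set.Icc 0 R, ℝ) →ₗ[ℝ] C(Set.Icc 0 R, ℝ) :=
    { toFun := fun f => f.toContinuousMap
      map_add' := fun _ _ => rfl
      map_smul' := fun _ _ => rfl }
  let Λ : C_c(Set.Icc 0 R, ℝ) →ₚ[ℝ] ℝ := PositiveLinearMap.mk₀ (g ∘ₗ T)
    fun f hf => hpos _ hf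
  set μ₀ := RealRMK.rieszMeasure Λ with hμ₀
  have : IsFiniteMeasure μ₀ := inferInstance
  refine ⟨μ₀.map Subtype.val, inferInstance, ?_, fun p => ?_⟩
  · refine isCompact_Icc.of_isClosed_subset Measure.isClosed_support
      (Measure.support_subset_of_isClosed (t := Set.Icc 0 R) isClosed_Icc ?_)
    rw [mem_ae_iff, Measure.map_apply measurable_subtype_coe measurableSet_Icc.compl]
    simp
  · rw [integral_map measurable_subtype_coe.aemeasurable
      (by fun_prop : Continuous fun x : ℝ≥0 => p.eval (x : ℝ)).aestronglyMeasurable, ← hg]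
    exact RealRMK.integral_rieszMeasure Λ
      (CompactlySupportedContinuousMap.continuousMapEquiv (polyRestrict _ p))

/-! ### Functionals given by their moments -/

/-- The linear functional on real polynomials with moments `γ`. -/
noncomputable def momentFunctional (γ : ℕ → ℝ) : ℝ[X] →ₗ[ℝ] ℝ :=
  Polynomial.lsum fun n => γ n • LinearMap.id

theorem momentFunctional_monomial (γ : ℕ → ℝ) (n : ℕ) (a : ℝ) :
    momentFunctional γ (monomial n a) = γ n * a := by
  simp [momentFunctional]

theorem momentFunctional_X_pow (γ : ℕ → ℝ) (n : ℕ) : momentFunctional γ (X ^ n) = γ n := by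
  rw [X_pow_eq_monomial, momentFunctional_monomial, mul_one]

theorem momentFunctional_X_mul (γ : ℕ → ℝ) (p : ℝ[X]) :
    momentFunctional γ (X * p) = momentFunctional (fun n => γ (n + 1)) p := by
  induction p using Polynomial.induction_on' with
  | add p q hp hq => rw [mul_add, map_add, map_add, hp, hq]
  | monomial n a => rw [X_mul_monomial, momentFunctional_monomial, momentFunctional_monomial]

theorem momentFunctional_smul (γ : ℕ → ℝ) (r : ℝ) (p : ℝ[X]) :
    momentFunctional (fun n => r * γ n) p = r * momentFunctional γ p := by
  induction p using Polynomial.induction_on' with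
  | add p q hp hq => rw [map_add, map_add, hp, hq, mul_add]
  | monomial n a => rw [momentFunctional_monomial, momentFunctional_monomial, mul_assoc]

/-- The second difference of a sequence. -/
def secondDiff (γ : ℕ → ℝ) (n : ℕ) : ℝ := γ (n + 2) - 2 * γ (n + 1) + γ n

theorem secondDiff_injective {f g : ℕ → ℝ} (h0 : f 0 = g 0) (h1 : f 1 = g 1)
    (h : ∀ n, secondDiff f n = secondDiff g n) (n : ℕ) : f n = g n := by
  induction n using Nat.twoStepInduction with
  | zero => exact h0
  | one => exact h1
  | more n ih1 ih2 =>
    have := h n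
    simp only [secondDiff] at this
    linarith

theorem momentFunctional_secondDiff (γ : ℕ → ℝ) (p : ℝ[X]) :
    momentFunctional (secondDiff γ) p = momentFunctional γ ((X - 1) ^ 2 * p) := by
  induction p using Polynomial.induction_on' with
  | add p q hp hq => rw [mul_add, map_add, map_add, hp, hq]
  | monomial n a =>
    have : (X - 1) ^ 2 * monomial n a =
        monomial (n + 2) a - (2 : ℝ) • monomial (n + 1) a + monomial n a := by
      simp only [← C_mul_X_pow_eq_monomial, smul_eq_C_mul, map_ofNat]; ring
    rw [this, map_add, map_sub, map_smul]
    simp only [momentFunctional_monomial, secondDiff, smul_eq_mul]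
    ring

theorem IsCPDSeq.momentFunctional_sq_nonneg {γ : ℕ → ℝ} (hγ : IsCPDSeq γ) {q : ℝ[X]}
    (hq : q.eval 1 = 0) : 0 ≤ momentFunctional γ (q ^ 2) := by
  have h := hγ q.natDegree (fun i => (q.coeff i : ℂ)) (by
    rw [eval_eq_sum_range] at hq
    simp only [one_pow, mul_one] at hq
    exact_mod_cast hq)
  have hL : momentFunctional γ (q ^ 2) = ∑ i ∈ Finset.range (q.natDegree + 1),
      ∑ j ∈ Finset.range (q.natDegree + 1), γ (i + j) * q.coeff i * q.coeff j := by
    rw [_root_.sq]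
    conv_lhs => rw [q.as_sum_range, Finset.sum_mul_sum, map_sum]
    refine Finset.sum_congr rfl fun i _ => ?_
    rw [map_sum]
    refine Finset.sum_congr rfl fun j _ => ?_
    rw [monomial_mul_monomial, momentFunctional_monomial, mul_assoc]
  rw [hL]
  simp only [Complex.conj_ofReal] at h
  exact_mod_cast h

theorem IsCPDSeq.momentFunctional_secondDiff_sq_nonneg {γ : ℕ → ℝ} (hγ : IsCPDSeq γ) (q : ℝ[X]) :
    0 ≤ momentFunctional (secondDiff γ) (q ^ 2) := by
  rw [momentFunctional_secondDiff, ← mul_pow]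
  exact hγ.momentFunctional_sq_nonneg (by simp)

end Polynomials

open MeasureTheory

/-! ### Moments of the weighted shift -/

theorem moment_pos (lam : Weights) (n : ℕ) : 0 < moment lam n :=
  Finset.prod_pos fun i _ => pow_pos (lam.pos i) 2

theorem moment_zero (lam : Weights) : moment lam 0 = 1 := by simp [moment]

theorem moment_succ (lam : Weights) (n : ℕ) :
    moment lam (n + 1) = moment lam n * lam.seq n ^ 2 := by
  simp [moment, Finset.prod_range_succ]

theorem norm_e (n : ℕ) : ‖e n‖ = 1 := by
  simp [e, lp.norm_single]

theorem W_pow_e (lam : Weights) (n m : ℕ) :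
    (W lam ^ n) (e m) = ((∏ i ∈ Finset.range n, lam.seq (m + i) : ℝ) : ℂ) • e (m + n) := by
  induction n with
  | zero => simp
  | succ n ih =>
    rw [pow_succ', mul_apply_eq_comp, ih, map_smul, W_e, smul_smul,
      Finset.prod_range_succ, add_assoc]
    push_cast
    rfl

theorem norm_W_pow_e_sq (lam : Weights) (n m : ℕ) :
    ‖(W lam ^ n) (e m)‖ ^ 2 = (moment lam m)⁻¹ * moment lam (m + n) := by
  rw [W_pow_e, norm_smul, norm_e, mul_one, Complex.norm_real, Real.norm_eq_abs, sq_abs]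
  rw [moment, moment, Finset.prod_range_add, Finset.prod_pow, Finset.prod_pow, ← mul_assoc,
    inv_mul_cancel₀, one_mul]
  exact pow_ne_zero _ (Finset.prod_pos fun i _ => lam.pos i).ne'

theorem moment_le_pow {lam : Weights} {C : ℝ} (hC : ∀ n, lam.seq n ≤ C) (n : ℕ) :
    moment lam n ≤ (C ^ 2) ^ n := by
  calc moment lam n ≤ ∏ _i ∈ Finset.range n, C ^ 2 :=
        Finset.prod_le_prod (fun i _ => sq_nonneg _)
          fun i _ => pow_le_pow_left₀ (lam.pos i).le (hC i) 2
    _ = _ := by simp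

/-- The second differences of the moments are Stieltjes moments: conditional positive definiteness
at `e 0` and at `e 1` gives positivity on `q ^ 2` and on `X * q ^ 2`. -/
theorem exists_measure_secondDiff (lam : Weights) (hW : IsCPD (W lam)) :
    ∃ μ : Measure ℝ≥0, IsFiniteMeasure μ ∧ IsCompact μ.support ∧
      ∀ n, ∫ x : ℝ≥0, (x : ℝ) ^ n ∂μ = secondDiff (moment lam) n := by
  have h0 : IsCPDSeq (moment lam) := by
    simpa only [norm_W_pow_e_sq, moment_zero, inv_one, one_mul, zero_add] using hW (e 0)
  have h1 : IsCPDSeq fun n => (moment lam 1)⁻¹ * moment lam (n + 1) := by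
    simpa only [norm_W_pow_e_sq, add_comm 1] using hW (e 1)
  obtain ⟨C₀, hC₀⟩ := lam.bdd
  set C := max C₀ 1
  have hC1 : 1 ≤ C := le_max_right _ _
  have hC : ∀ n, lam.seq n ≤ C := fun n => (hC₀ n).trans (le_max_left _ _)
  have hR : 0 < C ^ 2 := by positivity
  have hpos : IsPositiveOn (C ^ 2) (momentFunctional (secondDiff (moment lam))) := by
    refine isPositiveOn_of_growth (K := 4 * (C ^ 2) ^ 2) hR
      h0.momentFunctional_secondDiff_sq_nonneg (fun q => ?_) (fun n => ?_)
    · have h2 := h1.momentFunctional_secondDiff_sq_nonneg q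
      have h3 : secondDiff (fun n => (moment lam 1)⁻¹ * moment lam (n + 1)) =
          fun n => (moment lam 1)⁻¹ * secondDiff (moment lam) (n + 1) := by
        funext n; simp only [secondDiff]; ring
      rw [h3, momentFunctional_smul, ← momentFunctional_X_mul] at h2
      exact nonneg_of_mul_nonneg_right h2 (inv_pos.2 (moment_pos lam 1))
    · -- `|β n| ≤ 4 C ^ (2 (n + 2))`, since `C ≥ 1` makes the bounds of the moments increasing.
      rw [momentFunctional_X_pow, secondDiff, abs_le]
      have hb : ∀ k ≤ 2, 0 < moment lam (n + k) ∧ moment lam (n + k) ≤ (C ^ 2) ^ (n + 2) :=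
        fun k hk => ⟨moment_pos _ _, (moment_le_pow hC _).trans
          (pow_le_pow_right₀ (one_le_pow₀ hC1) (by omega))⟩
      have e0 := hb 0 (by omega)
      have e1 := hb 1 (by omega)
      have e2 := hb 2 (by omega)
      have e3 : 4 * (C ^ 2) ^ 2 * (C ^ 2) ^ n = 4 * (C ^ 2) ^ (n + 2) := by ring
      rw [add_zero] at e0
      rw [e3]
      constructor <;> linarith
  obtain ⟨μ, hμ, hc, hint⟩ := hpos.exists_measure hR
  refine ⟨μ, hμ, hc, fun n => ?_⟩
  rw [← momentFunctional_X_pow (secondDiff _), ← hint]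
  simp

/-! ### The scalar representing triplet -/

theorem integrable_of_continuous {μ : Measure ℝ≥0} [IsFiniteMeasure μ] (hμ : IsCompact μ.support)
    {f : ℝ≥0 → ℝ} (hf : Continuous f) : Integrable f μ := by
  have h := hf.continuousOn.integrableOn_compact (μ := μ) hμ
  have hr : μ.restrict μ.support = μ := Measure.restrict_eq_self_of_ae_mem Measure.support_mem_ae
  rwa [IntegrableOn, hr] at h

theorem Q_secondDiff (n : ℕ) (x : ℝ) : Q (n + 2) x - 2 * Q (n + 1) x + Q n x = x ^ n := by
  -- The summand with `j = m - 1` vanishes, so the sum may run over `j < m - 1` or over `j < m`.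
  have h : ∀ m k : ℕ, m = k ∨ m = k + 1 →
      Q m x = ∑ j ∈ Finset.range k, ((m : ℝ) - j - 1) * x ^ j := by
    rintro m k (rfl | rfl)
    · rcases m with _ | m
      · simp [Q]
      · rw [Q, Finset.sum_range_succ]
        simp only [Nat.add_sub_cancel]
        rw [show (((m + 1 : ℕ) : ℝ) - m - 1) * x ^ m = 0 by push_cast; ring, add_zero]
        refine Finset.sum_congr rfl fun j hj => ?_
        have := Finset.mem_range.1 hj
        rw [Nat.sub_sub, Nat.cast_sub (by omega)]
        push_cast; ring
    · rw [Q]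
      refine Finset.sum_congr rfl fun j hj => ?_
      have := Finset.mem_range.1 hj
      rw [Nat.sub_sub, Nat.cast_sub (by omega)]
      push_cast; ring
  rw [h (n + 2) (n + 1) (Or.inr rfl), h (n + 1) (n + 1) (Or.inl rfl), h n n (Or.inl rfl),
    Finset.sum_range_succ, Finset.sum_range_succ]
  have : ∑ j ∈ Finset.range n, (((n + 2 : ℕ) : ℝ) - j - 1) * x ^ j
      - 2 * ∑ j ∈ Finset.range n, (((n + 1 : ℕ) : ℝ) - j - 1) * x ^ j
      + ∑ j ∈ Finset.range n, ((n : ℝ) - j - 1) * x ^ j = 0 := by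
    rw [Finset.mul_sum, ← Finset.sum_sub_distrib, ← Finset.sum_add_distrib]
    refine Finset.sum_eq_zero fun j _ => ?_
    push_cast; ring
  push_cast at this ⊢
  linear_combination this

theorem continuous_Q (n : ℕ) : Continuous (Q n) := by
  unfold Q; fun_prop

theorem secondDiff_triplet {μ : Measure ℝ≥0} [IsFiniteMeasure μ] (hμ : IsCompact μ.support)
    (b c : ℝ) (n : ℕ) :
    secondDiff (fun n => 1 + b * n + c * (n : ℝ) ^ 2 + ∫ x, Q n (x : ℝ) ∂μ) n =
      2 * c + ∫ x : ℝ≥0, (x : ℝ) ^ n ∂μ := by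
  have hi : ∀ n, Integrable (fun x : ℝ≥0 => Q n (x : ℝ)) μ := fun n =>
    integrable_of_continuous hμ ((continuous_Q n).comp NNReal.continuous_coe)
  have : ∫ x : ℝ≥0, (x : ℝ) ^ n ∂μ = ∫ x, Q (n + 2) (x : ℝ) ∂μ -
      2 * ∫ x, Q (n + 1) (x : ℝ) ∂μ + ∫ x, Q n (x : ℝ) ∂μ := by
    rw [← integral_const_mul, ← integral_sub (hi _) ((hi _).const_mul 2),
      ← integral_add (f := fun x : ℝ≥0 => Q (n + 2) (x : ℝ) - 2 * Q (n + 1) (x : ℝ))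
        ((hi _).sub ((hi _).const_mul 2)) (hi _)]
    simp only [Q_secondDiff]
  rw [this]
  simp only [secondDiff]
  push_cast
  ring

theorem IsScalarTriplet.secondDiff_eq {lam : Weights} {b c : ℝ} {ν : Measure ℝ≥0}
    (h : IsScalarTriplet lam b c ν) (n : ℕ) :
    secondDiff (moment lam) n = 2 * c + ∫ x : ℝ≥0, (x : ℝ) ^ n ∂ν := by
  have := h.finite
  rw [← secondDiff_triplet h.compact_support b c]
  exact congrArg (secondDiff · n) (funext h.moment_eq)

/-- Existence of the scalar representing triplet: the constant `c` is half the mass at `1` of the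
measure representing the second differences, and `ν` is its part off `1`. -/
theorem exists_isScalarTriplet (lam : Weights) (hW : IsCPD (W lam)) :
    ∃ (b c : ℝ) (ν : Measure ℝ≥0), IsScalarTriplet lam b c ν := by
  obtain ⟨μ, hfin, hc, hint⟩ := exists_measure_secondDiff lam hW
  set ν := μ.restrict {1}ᶜ with hν
  have hνc : IsCompact ν.support := hc.of_isClosed_subset Measure.isClosed_support
    (Measure.support_mono Measure.restrict_le_self)
  refine ⟨moment lam 1 - 1 - μ.real {1} / 2, μ.real {1} / 2, ν, by positivity, inferInstance, hνc,
    by simp [hν], secondDiff_injective ?_ ?_ fun n => ?_⟩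
  · simp [moment_zero, Q]
  · simp [Q]
    ring
  · rw [secondDiff_triplet hνc, ← hint,
      ← integral_add_compl (measurableSet_singleton 1)
        (integrable_of_continuous hc (by fun_prop : Continuous fun x : ℝ≥0 => (x : ℝ) ^ n)),
      integral_singleton]
    simp
    ring

/-! ### Second differences and types -/

theorem IsScalarTriplet.secondDiff_nonneg {lam : Weights} {b c : ℝ} {ν : Measure ℝ≥0}
    (h : IsScalarTriplet lam b c ν) (n : ℕ) : 0 ≤ secondDiff (moment lam) n := by
  rw [h.secondDiff_eq]
  have := h.c_nonneg
  have : 0 ≤ ∫ x : ℝ≥0, (x : ℝ) ^ n ∂ν := integral_nonneg fun x => by positivity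
  positivity

theorem IsScalarTriplet.secondDiff_pos {lam : Weights} {b c : ℝ} {ν : Measure ℝ≥0}
    (h : IsScalarTriplet lam b c ν) (h3 : ¬ ν.support ⊆ {0} ∨ c ≠ 0) (n : ℕ) :
    0 < secondDiff (moment lam) n := by
  rw [h.secondDiff_eq]
  have hc := h.c_nonneg
  have hn : 0 ≤ ∫ x : ℝ≥0, (x : ℝ) ^ n ∂ν := integral_nonneg fun x => by positivity
  rcases h3 with h3 | h3
  · have := h.finite
    obtain ⟨x, hx, hx0⟩ := Set.not_subset.1 h3
    have hpos : 0 < ∫ x : ℝ≥0, (x : ℝ) ^ n ∂ν := by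
      rw [integral_pos_iff_support_of_nonneg (fun x => by positivity)
        (integrable_of_continuous h.compact_support (by fun_prop))]
      refine ((Measure.mem_support_iff_forall x).1 hx {0}ᶜ
        (isOpen_compl_singleton.mem_nhds hx0)).trans_le (measure_mono fun y hy => ?_)
      exact pow_ne_zero n (NNReal.coe_ne_zero.2 hy)
    linarith
  · have : 0 < c := lt_of_le_of_ne hc (Ne.symm h3)
    linarith

theorem IsScalarTriplet.secondDiff_eq_zero {lam : Weights} {b c : ℝ} {ν : Measure ℝ≥0}
    (h : IsScalarTriplet lam b c ν) (h3 : ν.support ⊆ {0}) (hc : c = 0) {n : ℕ} (hn : n ≠ 0) :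
    secondDiff (moment lam) n = 0 := by
  rw [h.secondDiff_eq, hc, mul_zero, zero_add]
  refine integral_eq_zero_of_ae ?_
  filter_upwards [Measure.support_mem_ae (μ := ν)] with x hx
  rw [show x = 0 from h3 hx]
  simp [hn]

theorem isTypeIII_iff {lam : Weights} (hW : IsCPD (W lam)) :
    IsTypeIII lam ↔ ∀ n, 0 < secondDiff (moment lam) n := by
  refine ⟨fun ⟨_, b, c, ν, h, h3⟩ => h.secondDiff_pos h3, fun hpos => ⟨hW, ?_⟩⟩
  obtain ⟨b, c, ν, h⟩ := exists_isScalarTriplet lam hW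
  refine ⟨b, c, ν, h, ?_⟩
  by_contra! h3
  exact (hpos 1).ne' (h.secondDiff_eq_zero h3.1 h3.2 one_ne_zero)

/-- A dichotomy: if the second differences of the moments are not all positive, then they all vanish
from index `1` on. -/
theorem secondDiff_pos_iff {lam : Weights} (hW : IsCPD (W lam)) :
    (∀ n, 0 < secondDiff (moment lam) n) ↔ ¬ ∀ n ≠ 0, secondDiff (moment lam) n = 0 := by
  refine ⟨fun h h' => (h 1).ne' (h' 1 one_ne_zero), fun h => ?_⟩
  obtain ⟨b, c, ν, ht⟩ := exists_isScalarTriplet lam hW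
  refine ht.secondDiff_pos ?_
  by_contra! h3
  exact h fun n hn => ht.secondDiff_eq_zero h3.1 h3.2 hn

theorem isTypeI_iff {lam : Weights} (hW : IsCPD (W lam)) :
    IsTypeI lam ↔ ∀ n, secondDiff (moment lam) n = 0 := by
  constructor
  · rintro ⟨-, b, c, ν, h, rfl, rfl⟩ n
    simp [h.secondDiff_eq]
  · refine fun h => ⟨hW, moment lam 1 - 1, 0, 0, ⟨le_rfl, inferInstance, by simp, by simp, ?_⟩,
      rfl, rfl⟩
    refine secondDiff_injective (by simp [moment_zero]) (by simp) fun n => ?_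
    rw [h, secondDiff_triplet (by simp)]
    simp

/-! ### The model shifts -/

/-- The eigenvalue of `B 2 (W lam)` at `e n`. -/
def eigB (lam : Weights) (n : ℕ) : ℝ :=
  1 - 2 * lam.seq n ^ 2 + lam.seq n ^ 2 * lam.seq (n + 1) ^ 2

theorem secondDiff_moment (lam : Weights) (n : ℕ) :
    secondDiff (moment lam) n = moment lam n * eigB lam n := by
  rw [secondDiff, moment_succ, moment_succ, eigB]
  ring

theorem eigB_pos_iff (lam : Weights) (n : ℕ) :
    0 < eigB lam n ↔ 0 < secondDiff (moment lam) n := by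
  rw [secondDiff_moment, mul_pos_iff_of_pos_left (moment_pos lam n)]

theorem eigB_eq_zero_iff (lam : Weights) (n : ℕ) :
    eigB lam n = 0 ↔ secondDiff (moment lam) n = 0 := by
  simp [secondDiff_moment, (moment_pos lam n).ne']

theorem W_injective {lam lam' : Weights} (h : W lam = W lam') : lam.seq = lam'.seq := by
  funext n
  have h1 := W_e lam n
  rw [h, W_e] at h1
  have h2 := smul_left_injective ℂ (norm_ne_zero_iff.1 (by rw [norm_e]; exact one_ne_zero)) h1
  exact_mod_cast h2.symm

theorem W_congr {lam lam' : Weights} (h : lam.seq = lam'.seq) : W lam = W lam' := by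
  cases lam; cases lam'; cases h; rfl

theorem modelSeq_sq_zero {a : ℝ} (ha : 0 < a) (b : ℝ) : modelSeq a b 0 ^ 2 = a := by
  rw [modelSeq, if_pos rfl, Real.sq_sqrt ha.le]

theorem modelSeq_sq_succ {a b : ℝ} (hb : 1 ≤ b) (n : ℕ) :
    modelSeq a b (n + 1) ^ 2 = (1 + ((n : ℝ) + 1) * (b - 1)) / (1 + (n : ℝ) * (b - 1)) := by
  obtain ⟨h1, h2, -⟩ := modelSeq_aux hb n.succ_ne_zero
  rw [modelSeq, if_neg n.succ_ne_zero, Real.sq_sqrt (div_pos h1 h2).le]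
  push_cast
  rw [add_sub_cancel_right]

theorem eigB_zero_of_model {lam : Weights} {a b : ℝ} (ha : 0 < a) (hb : 1 ≤ b)
    (h : lam.seq = modelSeq a b) : eigB lam 0 = 1 - 2 * a + a * b := by
  rw [eigB, h, modelSeq_sq_zero ha, modelSeq_sq_succ hb]
  simp

theorem eigB_succ_of_model {lam : Weights} {a b : ℝ} (hb : 1 ≤ b)
    (h : lam.seq = modelSeq a b) (n : ℕ) : eigB lam (n + 1) = 0 := by
  have h0 : 0 < 1 + (n : ℝ) * (b - 1) := by
    have := mul_nonneg (Nat.cast_nonneg (α := ℝ) n) (sub_nonneg.2 hb); linarith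
  have h1 : 0 < 1 + ((n : ℝ) + 1) * (b - 1) := by
    have := mul_nonneg (Nat.cast_nonneg (α := ℝ) n) (sub_nonneg.2 hb); linarith
  rw [eigB, h, modelSeq_sq_succ hb, modelSeq_sq_succ hb]
  push_cast
  field_simp
  ring

theorem moment_succ_eq_affine {lam : Weights} (h : ∀ n ≠ 0, secondDiff (moment lam) n = 0)
    (n : ℕ) : moment lam (n + 1) = moment lam 1 * (1 + n * (lam.seq 1 ^ 2 - 1)) := by
  refine secondDiff_injective (f := fun n => moment lam (n + 1))
    (g := fun n => moment lam 1 * (1 + n * (lam.seq 1 ^ 2 - 1))) (by simp) ?_ (fun n => ?_) n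
  · simp [moment_succ]
  · have := h (n + 1) n.succ_ne_zero
    rw [secondDiff] at this ⊢
    rw [this]
    simp only [secondDiff]
    push_cast
    ring

/-- If the second differences vanish off `0`, the shift is a model shift: the moments are affine
from index `1` on; as they are positive, the slope is nonnegative. -/
theorem exists_model {lam : Weights} (h0 : 0 ≤ secondDiff (moment lam) 0)
    (h : ∀ n ≠ 0, secondDiff (moment lam) n = 0) :
    ∃ a b : ℝ, 0 < a ∧ 1 ≤ b ∧ 0 ≤ 1 - 2 * a + a * b ∧ lam.seq = modelSeq a b := by
  have hm1 := moment_pos lam 1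
  have hpos : ∀ n : ℕ, 0 < 1 + (n : ℝ) * (lam.seq 1 ^ 2 - 1) := fun n =>
    pos_of_mul_pos_right (moment_succ_eq_affine h n ▸ moment_pos lam (n + 1)) hm1.le
  have hb : 1 ≤ lam.seq 1 ^ 2 := by
    by_contra! hlt
    obtain ⟨n, hn⟩ := exists_nat_gt (1 / (1 - lam.seq 1 ^ 2))
    rw [div_lt_iff₀ (by linarith)] at hn
    linarith [hpos n]
  refine ⟨lam.seq 0 ^ 2, lam.seq 1 ^ 2, pow_pos (lam.pos 0) 2, hb, ?_, funext fun n => ?_⟩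
  · rw [secondDiff_moment, moment_zero, one_mul, eigB] at h0
    exact h0
  · rcases n with _ | n
    · rw [modelSeq, if_pos rfl, Real.sqrt_sq (lam.pos 0).le]
    · refine (pow_left_inj₀ (lam.pos _).le (modelSeq_pos (pow_pos (lam.pos 0) 2) hb _).le
        two_ne_zero).1 ?_
      have h1 := moment_succ lam (n + 1)
      rw [moment_succ_eq_affine h (n + 1), moment_succ_eq_affine h n] at h1
      rw [modelSeq_sq_succ hb, eq_div_iff (hpos n).ne']
      push_cast at h1
      exact mul_left_cancel₀ hm1.ne' (by linear_combination -h1)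

/-! ### The quadratic form of `B 2` -/

section Operators

variable {H : Type*} [NormedAddCommGroup H] [InnerProductSpace ℂ H] [CompleteSpace H]

theorem inner_B_two (T : H →L[ℂ] H) (h : H) :
    ⟪B 2 T h, h⟫_ℂ = ((‖h‖ ^ 2 - 2 * ‖T h‖ ^ 2 + ‖T (T h)‖ ^ 2 : ℝ) : ℂ) := by
  have h1 : B 2 T h = h - (2 : ℂ) • ContinuousLinearMap.adjoint T (T h) +
      ContinuousLinearMap.adjoint T (ContinuousLinearMap.adjoint T (T (T h))) := by
    simp [B, Finset.sum_range_succ, pow_two, sub_eq_add_neg]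
  rw [h1, inner_add_left, inner_sub_left, inner_smul_left]
  simp only [ContinuousLinearMap.adjoint_inner_left, inner_self_eq_norm_sq_to_K, map_ofNat]
  push_cast
  rfl

theorem isMIsometry_two_iff (T : H →L[ℂ] H) :
    IsMIsometry 2 T ↔ ∀ h, ‖h‖ ^ 2 - 2 * ‖T h‖ ^ 2 + ‖T (T h)‖ ^ 2 = 0 := by
  constructor
  · intro hT h
    have := inner_B_two T h
    rw [show B 2 T = 0 from hT, zero_apply, inner_zero_left] at this
    exact_mod_cast this.symm
  · intro hT
    have : (B 2 T : H →ₗ[ℂ] H) = 0 := by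
      rw [← inner_map_self_eq_zero]
      intro h
      rw [ContinuousLinearMap.coe_coe, inner_B_two, hT, Complex.ofReal_zero]
    exact ContinuousLinearMap.coe_inj.1 this

/-- A positive quadratic form is a squared norm, by means of the positive square root. -/
theorem exists_inner_eq_norm_sq {T : H →L[ℂ] H} (hT : T.IsPositive) :
    ∃ S : H →L[ℂ] H, ∀ h, RCLike.re ⟪T h, h⟫_ℂ = ‖S h‖ ^ 2 := by
  have hT0 : 0 ≤ T := T.nonneg_iff_isPositive.2 hT
  refine ⟨CFC.sqrt T, fun h => ?_⟩
  have hS : IsSelfAdjoint (CFC.sqrt T) := (CFC.sqrt_nonneg T).isSelfAdjoint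
  have h1 : ⟪T h, h⟫_ℂ = ⟪CFC.sqrt T h, CFC.sqrt T h⟫_ℂ := by
    conv_lhs => rw [← CFC.sqrt_mul_sqrt_self T hT0]
    exact hS.isSymmetric _ _
  rw [h1, inner_self_eq_norm_sq]

end Operators

theorem hasSum_norm_W_sq (lam : Weights) (h : L2) :
    HasSum (fun n => lam.seq n ^ 2 * ‖h n‖ ^ 2) (‖W lam h‖ ^ 2) := by
  have hs : HasSum (fun n => ‖W lam h n‖ ^ 2) (‖W lam h‖ ^ 2) := by
    rw [norm_sq_eq]; exact (summable_sq _).hasSum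
  rw [← hasSum_nat_add_iff' 1] at hs
  have h0 : W lam h 0 = 0 := rfl
  have h1 : ∀ n, W lam h (n + 1) = lam.seq n * h n := fun n => rfl
  simpa [h0, h1, mul_pow] using hs

theorem hasSum_norm_W_W_sq (lam : Weights) (h : L2) :
    HasSum (fun n => lam.seq n ^ 2 * lam.seq (n + 1) ^ 2 * ‖h n‖ ^ 2) (‖W lam (W lam h)‖ ^ 2) := by
  have hs := hasSum_norm_W_sq lam (W lam h)
  rw [← hasSum_nat_add_iff' 1] at hs
  have h0 : W lam h 0 = 0 := rfl
  have h1 : ∀ n, W lam h (n + 1) = lam.seq n * h n := fun n => rfl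
  simp only [h1, norm_mul, mul_pow, Finset.range_one, Finset.sum_singleton, h0, norm_zero] at hs
  simp only [Complex.norm_real, Real.norm_eq_abs, sq_abs] at hs
  rw [zero_pow two_ne_zero, mul_zero, sub_zero] at hs
  have hfun : (fun n => lam.seq n ^ 2 * lam.seq (n + 1) ^ 2 * ‖h n‖ ^ 2) =
      fun n => lam.seq (n + 1) ^ 2 * (lam.seq n ^ 2 * ‖h n‖ ^ 2) := by funext n; ring
  rwa [hfun]

theorem hasSum_eigB (lam : Weights) (h : L2) :
    HasSum (fun n => eigB lam n * ‖h n‖ ^ 2)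
      (‖h‖ ^ 2 - 2 * ‖W lam h‖ ^ 2 + ‖W lam (W lam h)‖ ^ 2) := by
  have h0 : HasSum (fun n => ‖h n‖ ^ 2) (‖h‖ ^ 2) := by
    rw [norm_sq_eq]; exact (summable_sq _).hasSum
  have hfun : (fun n => eigB lam n * ‖h n‖ ^ 2) = fun n => ‖h n‖ ^ 2 -
      2 * (lam.seq n ^ 2 * ‖h n‖ ^ 2) + lam.seq n ^ 2 * lam.seq (n + 1) ^ 2 * ‖h n‖ ^ 2 := by
    funext n; rw [eigB]; ring
  rw [hfun]
  exact (h0.sub ((hasSum_norm_W_sq lam h).mul_left 2)).add (hasSum_norm_W_W_sq lam h)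

theorem e_apply_self (n : ℕ) : e n n = 1 := by simp [e]

theorem e_apply_of_ne {n m : ℕ} (h : m ≠ n) : e n m = 0 := by simp [e, h]

theorem form_e (lam : Weights) (n : ℕ) :
    ‖e n‖ ^ 2 - 2 * ‖W lam (e n)‖ ^ 2 + ‖W lam (W lam (e n))‖ ^ 2 = eigB lam n := by
  refine (hasSum_eigB lam (e n)).unique ?_
  convert hasSum_single (f := fun m => eigB lam m * ‖e n m‖ ^ 2) n fun m hm => ?_ using 1
  · simp [e_apply_self]
  · simp [e_apply_of_ne hm]

theorem e_mem_M {n : ℕ} (hn : n ≠ 0) : e n ∈ M :=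
  Submodule.le_topologicalClosure _
    (Submodule.subset_span ⟨n, Nat.one_le_iff_ne_zero.2 hn, rfl⟩)

theorem apply_zero_of_mem_M {h : L2} (hh : h ∈ M) : h 0 = 0 := by
  have hle : M ≤ (innerSL ℂ (e 0)).toLinearMap.ker := by
    refine Submodule.topologicalClosure_minimal _ (Submodule.span_le.2 ?_)
      (innerSL ℂ (e 0)).isClosed_ker
    rintro _ ⟨j, hj, rfl⟩
    change ⟪e 0, e j⟫_ℂ = 0
    rw [e, lp.inner_single_left, e_apply_of_ne (by omega), inner_zero_right]
  have h1 : ⟪e 0, h⟫_ℂ = 0 := hle hh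
  rw [e, lp.inner_single_left] at h1
  simpa using h1

theorem isMIsometry_WM_iff (lam : Weights) :
    IsMIsometry 2 (WM lam) ↔ ∀ n ≠ 0, eigB lam n = 0 := by
  rw [isMIsometry_two_iff]
  have hval : ∀ h : M, ‖h‖ ^ 2 - 2 * ‖WM lam h‖ ^ 2 + ‖WM lam (WM lam h)‖ ^ 2 =
    ‖(h : L2)‖ ^ 2 - 2 * ‖W lam h‖ ^ 2 + ‖W lam (W lam h)‖ ^ 2 := fun h => rfl
  simp only [hval]
  constructor
  · intro hM n hn
    rw [← form_e]
    exact hM ⟨e n, e_mem_M hn⟩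
  · intro hd h
    refine (hasSum_eigB lam h).unique ?_
    convert (hasSum_zero : HasSum (fun _ : ℕ => (0 : ℝ)) 0) using 2 with n
    rcases eq_or_ne n 0 with rfl | hn
    · simp [apply_zero_of_mem_M h.2]
    · simp [hd n hn]

theorem norm2_eq (lam : Weights) (h : E) :
    norm2 lam h = √(‖(h : L2)‖ ^ 2 - 2 * ‖W lam h‖ ^ 2 + ‖W lam (W lam h)‖ ^ 2) := by
  rw [norm2, inner_B_two]
  congr 1

/-- The seminorm is the norm pulled back along the positive square root of `B 2 (W lam)`. -/
theorem exists_norm2_eq_norm {lam : Weights} (hd : ∀ n, 0 ≤ eigB lam n) :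
    ∃ S : L2 →L[ℂ] L2, ∀ h : E, norm2 lam h = ‖S h‖ := by
  have hB : (B 2 (W lam)).IsPositive := by
    rw [ContinuousLinearMap.isPositive_iff_complex]
    intro h
    rw [inner_B_two]
    exact ⟨rfl, (hasSum_eigB lam h).nonneg fun n => mul_nonneg (hd n) (sq_nonneg _)⟩
  obtain ⟨S, hS⟩ := exists_inner_eq_norm_sq hB
  exact ⟨S, fun h => by rw [norm2, hS, Real.sqrt_sq (norm_nonneg _)]⟩

theorem isNorm_norm2_iff {lam : Weights} (hd : ∀ n, 0 ≤ eigB lam n) :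
    IsNorm (norm2 lam) ↔ ∀ n, 0 < eigB lam n := by
  constructor
  · intro hN n
    refine lt_of_le_of_ne (hd n) fun h => ?_
    have h1 : norm2 lam ⟨e n, Submodule.subset_span ⟨n, rfl⟩⟩ = 0 := by
      rw [norm2_eq, form_e, ← h, Real.sqrt_zero]
    have h2 : e n = 0 := congrArg Subtype.val ((hN.eq_zero_iff _).1 h1)
    simpa [h2] using norm_e n
  · intro hpos
    obtain ⟨S, hS⟩ := exists_norm2_eq_norm hd
    refine ⟨fun v => Real.sqrt_nonneg _, fun v => ⟨fun hv => ?_, ?_⟩, fun c v => ?_, fun v w => ?_⟩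
    · have hsum := hasSum_eigB lam v
      have hnn : ∀ n, 0 ≤ eigB lam n * ‖(v : L2) n‖ ^ 2 := fun n =>
        mul_nonneg (hd n) (sq_nonneg _)
      rw [norm2_eq, Real.sqrt_eq_zero (hsum.nonneg hnn)] at hv
      rw [hv, hasSum_zero_iff_of_nonneg hnn] at hsum
      refine Subtype.ext (lp.ext (funext fun n => ?_))
      have := congrFun hsum n
      simpa [(hpos n).ne'] using this
    · rintro rfl
      simp [hS]
    · simp [hS, norm_smul]
    · simpa [hS] using norm_add_le (S v) (S w)

end CPDShift

theorem theorem2p12 (lam : CPDShift.Weights) (hW : CPDShift.IsCPD (CPDShift.W lam)) :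
    List.TFAE
      [ ¬ CPDShift.IsMIsometry 2 (CPDShift.WM lam),
        CPDShift.IsTypeIII lam,
        ∀ (a b : ℝ) (ha : 0 < a) (hb : 1 ≤ b), 0 ≤ 1 - 2 * a + a * b →
          CPDShift.W lam ≠ CPDShift.Wab a b ha hb,
        CPDShift.IsNorm (CPDShift.norm2 lam) ] ∧
    ∀ (a b : ℝ) (ha : 0 < a) (hb : 1 ≤ b), 0 ≤ 1 - 2 * a + a * b →
      CPDShift.W lam = CPDShift.Wab a b ha hb →
      (CPDShift.IsTypeI lam ↔ 1 - 2 * a + a * b = 0) := by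
  open CPDShift in
  obtain ⟨b₀, c₀, ν₀, ht⟩ := exists_isScalarTriplet lam hW
  have hnn := ht.secondDiff_nonneg
  have hd : ∀ n, 0 ≤ eigB lam n := fun n =>
    nonneg_of_mul_nonneg_right (secondDiff_moment lam n ▸ hnn n) (moment_pos lam n)
  refine ⟨?_, fun a b ha hb hab hmodel => ?_⟩
  · tfae_have 1 ↔ 2 := by
      rw [isTypeIII_iff hW, secondDiff_pos_iff hW, isMIsometry_WM_iff]
      simp only [eigB_eq_zero_iff]
    tfae_have 2 ↔ 4 := by
      rw [isTypeIII_iff hW, isNorm_norm2_iff hd]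
      simp only [eigB_pos_iff]
    tfae_have 2 ↔ 3 := by
      rw [isTypeIII_iff hW, secondDiff_pos_iff hW]
      refine ⟨fun h a b ha hb hab hmodel => h fun n hn => ?_, fun h hz => ?_⟩
      · obtain ⟨m, rfl⟩ := Nat.exists_eq_succ_of_ne_zero hn
        rw [← eigB_eq_zero_iff]
        exact eigB_succ_of_model hb (W_injective hmodel) m
      · obtain ⟨a, b, ha, hb, hab, hmodel⟩ := exists_model (hnn 0) hz
        exact h a b ha hb hab (W_congr hmodel)
    tfae_finish
  · have hseq : lam.seq = modelSeq a b := W_injective hmodel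
    rw [isTypeI_iff hW, ← eigB_zero_of_model ha hb hseq]
    simp only [← eigB_eq_zero_iff]
    refine ⟨fun h => h 0, fun h n => ?_⟩
    rcases n with _ | n
    · exact h
    · exact eigB_succ_of_model hb hseq n
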